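/- Let $(X,d)$ be a strongly discrete metric space of bounded geometry, i.e. $\{d(x,y):x,y\in X\}$ is a discrete subset of $\mathbb R$ and $\sup_{x\in X}|\{y: d(x,y)\le r\}|<\infty$ for every $r>0$. Let $C^*_u(X)\subseteq\mathfrak B(\ell^2(X))$ be the uniform Roe algebra, i.e. the norm closure of the operators $T$ of finite propagation ($T(x,y)=\langle T\delta_y,\delta_x\rangle$ vanishes when $d(x,y)$ is larger than some constant). Ideals are norm closed and two-sided; a maximal ideal is a proper ideal not properly contained in another proper ideal. Let $\beta X$ be the Stone–Čech compactification of the discrete set $X$ (the space of ultrafilters on $X$), $\partial_\beta X=\beta X\setminus X$, and let $G(X)=\bigcup_{r>0}\overline{\{(x,y): d(x,y)\le r\}}\subseteq\beta(X\times X)$ be the coarse groupoid, with range and source maps $\mathrm r,\mathrm s:G(X)\to\beta X$ extending the coordinate projections $(x,y)\mapsto x$ and $(x,y)\mapsto y$. A subset $Y\subseteq\beta X$ is invariant if $\mathrm r^{-1}(Y)=\mathrm s^{-1}(Y)$. An invariant open $U\subseteq\beta X$ is maximal if $U\ne\beta X$ and $U$ is not properly contained in any proper invariant open subset of $\beta X$;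 an invariant closed $K\subseteq\beta X$ is minimal if $K\neq\emptyset$ and $K$ does not properly contain any non-empty invariant closed subset of $\beta X$. For $T\in C^*_u(X)$ and $\varepsilon>0$ let $\mathrm{supp}_\varepsilon(T)=\{(x,y):|T(x,y)|\ge\varepsilon\}$, and write $\mathrm r(\mathrm{supp}_\varepsilon(T))\subseteq X$ for its projection to the first coordinate. With closures taken in $\beta X$, put $$\tilde I(U)=\{T\in C^*_u(X): \overline{\mathrm r(\mathrm{supp}_\varepsilon(T))}\subseteq U\text{ for all }\varepsilon>0\},\qquad U(I)=\bigcup_{T\in I,\ \varepsilon>0}\overline{\mathrm r(\mathrm{supp}_\varepsilon(T))}$$ for an invariant open set $U\subseteq\beta X$ and an ideal $I$ of $C^*_u(X)$. For $\omega\in\beta X$, let $X(\omega)$ (the limit space) be the set of all $t(\omega):=\lim_\omega t\in\beta X$, where $t:D\to R$ is a bijection between subsets of $X$ with $\sup_{x\in D}d(x,t(x))<\infty$ and $\omega(D)=1$. A point $\omega\in\partial_\beta X$ is minimal if $\overline{X(\omega)}$ is a minimal invariant closed subset of $\beta X$. Then: 1. For every maximal invariant open set $U\subseteq\beta X$, $\tilde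 I(U)$ is a maximal ideal of $C^*_u(X)$. Conversely, for every maximal ideal $I$ of $C^*_u(X)$, the set $U(I)$ is a maximal invariant open set and $I=\tilde I(U(I))$. 2. For every minimal invariant closed set $K\subseteq\beta X$, $\tilde I(\beta X\setminus K)$ is a maximal ideal of $C^*_u(X)$, and every maximal ideal of $C^*_u(X)$ is of this form. 3. If $X$ is infinite, then every minimal invariant closed set $K\subseteq\beta X$ equals $\overline{X(\omega)}$ for some minimal point $\omega\in\partial_\beta X$; consequently every maximal ideal of $C^*_u(X)$ equals $\tilde I(\beta X\setminus\overline{X(\omega)})$ for some minimal point $\omega\in\partial_\beta X$. Conversely, for every minimal point $\omega\in\partial_\beta X$, the set $\overline{X(\omega)}$ is a minimal invariant closed set. -/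

import Mathlib

open scoped ENNReal

noncomputable section

namespace Roe

/-- The set of distances `{d(x,y) : x, y ∈ X}` is a discrete subset of `ℝ`. -/
def StronglyDiscrete (X : Type*) [MetricSpace X] : Prop :=
  DiscreteTopology ↥(Set.range fun p : X × X => dist p.1 p.2)

/-- For each `r > 0` the cardinalities of the closed balls of radius `r` are finite and uniformly
bounded. -/
def BoundedGeometry (X : Type*) [MetricSpace X] : Prop :=
  ∀ r : ℝ, 0 < r → ∃ N : ℕ, ∀ x : X, (Metric.closedBall x r).encard ≤ N

/-! ### The uniform Roe algebra -/

/-- The Hilbert space `ℓ²(X)`. -/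
abbrev L2 (X : Type*) : Type _ := lp (fun _ : X => ℂ) 2

/-- The basis vector `δ_x` of `ℓ²(X)`. -/
def delta {X : Type*} (x : X) : L2 X :=
  letI := Classical.decEq X
  lp.single 2 x (1 : ℂ)

/-- The matrix coefficient `T(x,y) = ⟨T δ_y, δ_x⟩`, that is, the value of `T δ_y` at `x`. -/
def coeff {X : Type*} (T : L2 X →L[ℂ] L2 X) (x y : X) : ℂ :=
  (T (delta y) : L2 X) x

/-- `T(x,y) = 0` as soon as `d(x,y)` exceeds some constant. -/
def FinitePropagation {X : Type*} [MetricSpace X] (T : L2 X →L[ℂ] L2 X) : Prop :=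
  ∃ R : ℝ, ∀ x y : X, coeff T x y ≠ 0 → dist x y ≤ R

theorem inner_delta {X : Type*} (x : X) (f : L2 X) : inner ℂ (delta x) f = f x := by
  classical
  have h : delta x = lp.single 2 x (1 : ℂ) := by
    unfold delta; congr!
  rw [h, lp.inner_single_left]
  simp

theorem delta_apply_of_ne {X : Type*} {x y : X} (h : x ≠ y) : (delta y : L2 X) x = 0 := by
  classical
  have h' : delta y = lp.single 2 y (1 : ℂ) := by
    unfold delta; congr!
  rw [h']
  exact lp.single_apply_ne (E := fun _ : X => ℂ) 2 y (1 : ℂ) h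

theorem coeff_adjoint {X : Type*} (T : L2 X →L[ℂ] L2 X) (x y : X) :
    coeff (star T) x y = star (coeff T y x) := by
  unfold coeff
  rw [← inner_delta x, ← inner_delta y, ContinuousLinearMap.star_eq_adjoint,
    ContinuousLinearMap.adjoint_inner_right, ← inner_conj_symm]
  rfl

theorem coeff_mul_ne_zero {X : Type*} {S T : L2 X →L[ℂ] L2 X} {x y : X}
    (h : coeff (S * T) x y ≠ 0) : ∃ z, coeff S x z ≠ 0 ∧ coeff T z y ≠ 0 := by
  classical
  by_contra hc
  push Not at hc
  apply h
  have h1 : HasSum (fun z : X => lp.single (E := fun _ : X => ℂ) 2 z ((T (delta y) : L2 X) z))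
      (T (delta y)) := lp.hasSum_single (by simp) _
  have h2 := (h1.mapL S).mapL (innerSL ℂ (delta x))
  have h3 : ∀ z : X, (innerSL ℂ (delta x))
      (S (lp.single (E := fun _ : X => ℂ) 2 z ((T (delta y) : L2 X) z))) = 0 := by
    intro z
    have hz : lp.single (E := fun _ : X => ℂ) 2 z ((T (delta y) : L2 X) z)
        = ((T (delta y) : L2 X) z) • (delta z : L2 X) := by
      have h' : delta z = lp.single (E := fun _ : X => ℂ) 2 z (1 : ℂ) := by
        unfold delta; congr!
      rw [h', ← lp.single_smul]
      simp
    rw [hz, map_smul, map_smul, innerSL_apply_apply, inner_delta]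
    by_cases hS : coeff S x z = 0
    · unfold coeff at hS
      rw [hS, smul_zero]
    · have := hc z hS
      unfold coeff at this
      rw [this, zero_smul]
  simp only [h3] at h2
  have h4 := h2.unique hasSum_zero
  rw [innerSL_apply_apply, inner_delta] at h4
  exact h4

/-- The algebraic uniform Roe algebra `ℂ_u[X]`: the `*`-algebra of all bounded operators of
finite propagation. -/
def algebraicUniformRoeAlgebra (X : Type*) [MetricSpace X] :
    StarSubalgebra ℂ (L2 X →L[ℂ] L2 X) where
  carrier := {T | FinitePropagation T}
  mul_mem' := by
    rintro S T ⟨R, hR⟩ ⟨R', hR'⟩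
    refine ⟨R + R', fun x y h => ?_⟩
    obtain ⟨z, hz, hz'⟩ := coeff_mul_ne_zero h
    exact (dist_triangle x z y).trans (add_le_add (hR _ _ hz) (hR' _ _ hz'))
  add_mem' := by
    rintro S T ⟨R, hR⟩ ⟨R', hR'⟩
    refine ⟨max R R', fun x y h => ?_⟩
    by_cases hS : coeff S x y = 0
    · refine (hR' x y fun hT => h ?_).trans (le_max_right _ _)
      unfold coeff at hS hT ⊢
      simp [hS, hT]
    · exact (hR x y hS).trans (le_max_left _ _)
  algebraMap_mem' := by
    intro c
    refine ⟨0, fun x y h => ?_⟩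
    by_contra hd
    have hne : x ≠ y := fun e => hd (by simp [e])
    apply h
    unfold coeff
    rw [Algebra.algebraMap_eq_smul_one]
    simp [delta_apply_of_ne hne]
  star_mem' := by
    rintro T ⟨R, hR⟩
    refine ⟨R, fun x y h => ?_⟩
    rw [dist_comm]
    apply hR
    intro h0
    apply h
    rw [coeff_adjoint, h0, star_zero]

/-- The uniform Roe algebra `C*_u(X)`: the operator norm closure of `ℂ_u[X]`. -/
def uniformRoeAlgebra (X : Type*) [MetricSpace X] : StarSubalgebra ℂ (L2 X →L[ℂ] L2 X) :=
  (algebraicUniformRoeAlgebra X).topologicalClosure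

/-- An ideal of the `C*`-algebra `C*_u(X)`: a norm closed two-sided ideal. -/
def IsIdeal {X : Type*} [MetricSpace X] (I : Set (uniformRoeAlgebra X)) : Prop :=
  IsClosed I ∧ ∃ J : TwoSidedIdeal (uniformRoeAlgebra X), (J : Set (uniformRoeAlgebra X)) = I

/-- A maximal ideal: a proper ideal that is not properly contained in a proper ideal. -/
def IsMaximalIdeal {X : Type*} [MetricSpace X] (I : Set (uniformRoeAlgebra X)) : Prop :=
  IsIdeal I ∧ I ≠ Set.univ ∧
    ∀ J : Set (uniformRoeAlgebra X), IsIdeal J → I ⊆ J → J ≠ Set.univ → J = I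

/-! ### The Stone-Čech compactification and the coarse groupoid -/

/-- The Stone-Čech compactification `βX` of the discrete space `X`, realized as the space of
ultrafilters on `X` with the topology generated by the sets `{ω | A ∈ ω}`, `A ⊆ X`. A point `x`
of `X` is identified with the principal ultrafilter `pure x`. -/
abbrev Beta (X : Type*) : Type _ := Ultrafilter X

/-- The closure in `βX` of a subset of `X`. -/
def betaClosure {X : Type*} (A : Set X) : Set (Beta X) :=
  closure ((pure : X → Beta X) '' A)

/-- The Stone-Čech boundary `∂_β X = βX \ X`. -/
def boundary (X : Type*) : Set (Beta X) :=
  (Set.range (pure : X → Beta X))ᶜ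

/-- The `r`-entourage `E_r`. -/
def entourage (X : Type*) [MetricSpace X] (r : ℝ) : Set (X × X) :=
  {p | dist p.1 p.2 ≤ r}

/-- The coarse groupoid `G(X)`: the union over `r > 0` of the closures of `E_r` in `β(X × X)`. -/
def coarseGroupoid (X : Type*) [MetricSpace X] : Set (Beta (X × X)) :=
  ⋃ r : ℝ, ⋃ _ : 0 < r, betaClosure (entourage X r)

/-- The range map `β(X × X) → βX`, extending `(x,y) ↦ x`. -/
def rangeMap {X : Type*} (γ : Beta (X × X)) : Beta X := Ultrafilter.map Prod.fst γ

/-- The source map `β(X × X) → βX`, extending `(x,y) ↦ y`. -/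
def sourceMap {X : Type*} (γ : Beta (X × X)) : Beta X := Ultrafilter.map Prod.snd γ

/-- `U ⊆ βX` is invariant if `r⁻¹(U) = s⁻¹(U)` in `G(X)`. -/
def IsInvariant {X : Type*} [MetricSpace X] (U : Set (Beta X)) : Prop :=
  ∀ γ ∈ coarseGroupoid X, rangeMap γ ∈ U ↔ sourceMap γ ∈ U

/-- A maximal invariant open subset of `βX`. -/
def IsMaximalInvariantOpen {X : Type*} [MetricSpace X] (U : Set (Beta X)) : Prop :=
  (IsOpen U ∧ IsInvariant U) ∧ U ≠ Set.univ ∧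
    ∀ V : Set (Beta X), IsOpen V → IsInvariant V → V ≠ Set.univ → ¬ U ⊂ V

/-- A minimal invariant closed subset of `βX`. -/
def IsMinimalInvariantClosed {X : Type*} [MetricSpace X] (K : Set (Beta X)) : Prop :=
  (IsClosed K ∧ IsInvariant K) ∧ K ≠ ∅ ∧
    ∀ L : Set (Beta X), IsClosed L → IsInvariant L → L ≠ ∅ → ¬ L ⊂ K

/-! ### Ghostly ideals and the open set of an ideal -/

/-- The `ε`-support of an operator. -/
def epsSupport {X : Type*} (T : L2 X →L[ℂ] L2 X) (ε : ℝ) : Set (X × X) :=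
  {p | ε ≤ ‖coeff T p.1 p.2‖}

/-- The ghostly ideal `Ĩ(U)`: all `T ∈ C*_u(X)` such that, for every `ε > 0`, the closure in `βX`
of the projection of the `ε`-support of `T` to the first coordinate lies in `U`. -/
def ghostlyIdeal {X : Type*} [MetricSpace X] (U : Set (Beta X)) : Set (uniformRoeAlgebra X) :=
  {T | ∀ ε : ℝ, 0 < ε →
    betaClosure (Prod.fst '' epsSupport (T : L2 X →L[ℂ] L2 X) ε) ⊆ U}

/-- The subset `U(I)` of `βX` associated with an ideal `I` of `C*_u(X)`. -/
def openSetOf {X : Type*} [MetricSpace X] (I : Set (uniformRoeAlgebra X)) : Set (Beta X) :=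
  ⋃ T ∈ I, ⋃ ε : ℝ, ⋃ _ : 0 < ε,
    betaClosure (Prod.fst '' epsSupport (T : L2 X →L[ℂ] L2 X) ε)

/-! ### Limit spaces and minimal points -/

/-- A partial translation of `X`: a bijection `t : D → R` between subsets of `X` (the values of the
underlying function outside its source `D` are irrelevant) with `d(x, t(x))` bounded on `D`. -/
def IsPartialTranslation {X : Type*} [MetricSpace X] (t : PartialEquiv X X) : Prop :=
  ∃ C : ℝ, ∀ x ∈ t.source, dist x (t x) ≤ C

/-- The (underlying set of the) limit space `X(ω)`: all `α = t(ω)`, where `t : D → R` is a partial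
translation with `ω(D) = 1`, and `t(ω) = lim_ω t` is the image of `ω` under `t`. -/
def limitSpace {X : Type*} [MetricSpace X] (ω : Beta X) : Set (Beta X) :=
  {α | ∃ t : PartialEquiv X X, IsPartialTranslation t ∧ t.source ∈ ω ∧ Ultrafilter.map t ω = α}

/-- A minimal point: a boundary point `ω` such that the closure of `X(ω)` is a minimal invariant
closed subset of `βX`. -/
def IsMinimalPoint {X : Type*} [MetricSpace X] (ω : Beta X) : Prop :=
  ω ∈ boundary X ∧ IsMinimalInvariantClosed (closure (limitSpace ω))

end Roe

end

noncomputable section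

namespace Roe

open Filter Topology

/-! ### Closures in the Stone-Čech compactification -/

/-! The maps I ↦ U(I) and U ↦ Ĩ(U) are monotone, I ⊆ Ĩ(U(I)), and U(Ĩ(U)) = U for open U. Once both
are known to preserve properness and to exchange closed ideals with invariant open sets, maximal
elements on the two sides correspond formally, and complements give the version with minimal closed
sets.

The analytic core is `indicatorElem_fst_image_epsSupport_mem`: if T lies in a closed ideal J, then
so does the projection onto r(supp_ε T). Hence U(J) is the union of the closures of those A whose
indicator lies in J. These A are stable under subsets, finite unions and metric neighbourhoods.
Stability under neighbourhoods makes U(J) invariant; stability under unions and compactness of βX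
give 1 ∈ J as soon as U(J) = βX. Conversely, multiplication by an operator of finite propagation
moves rows by a bounded distance only, so Ĩ(U) is an ideal when U is invariant.

Bounded geometry enters mainly through finite colourings. They cut a relation of bounded distance
into finitely many graphs of partial translations, which act as bounded operators. They also show
that X(ω) is the groupoid orbit of ω, so a minimal invariant closed set is the closure of the orbit
of any of its points. For infinite X such a set lies in the boundary, because a closed invariant set
containing a point of X is all of βX. -/

theorem mem_betaClosure {X : Type*} {A : Set X} {ω : Beta X} : ω ∈ betaClosure A ↔ A ∈ ω := by
  constructor
  · intro h
    have hsub : betaClosure A ⊆ {u : Ultrafilter X | A ∈ u} := by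
      refine closure_minimal ?_ (ultrafilter_isClosed_basic A)
      rintro _ ⟨x, hx, rfl⟩
      exact hx
    exact hsub h
  · intro h
    refine ultrafilterBasis_is_basis.mem_closure_iff.2 ?_
    rintro _ ⟨B, rfl⟩ hB
    obtain ⟨x, hxA, hxB⟩ := Ultrafilter.nonempty_of_mem (inter_mem h hB)
    exact ⟨pure x, hxB, x, hxA, rfl⟩

theorem isOpen_betaClosure {X : Type*} (A : Set X) : IsOpen (betaClosure A) := by
  have : betaClosure A = {u : Ultrafilter X | A ∈ u} := Set.ext fun _ => mem_betaClosure
  exact this ▸ ultrafilter_isOpen_basic A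

theorem betaClosure_mono {X : Type*} {A B : Set X} (h : A ⊆ B) : betaClosure A ⊆ betaClosure B :=
  closure_mono (Set.image_mono h)

theorem betaClosure_union {X : Type*} (A B : Set X) :
    betaClosure (A ∪ B) = betaClosure A ∪ betaClosure B := by
  unfold betaClosure
  rw [Set.image_union, closure_union]

theorem betaClosure_univ {X : Type*} : betaClosure (Set.univ : Set X) = Set.univ :=
  Set.eq_univ_of_forall fun _ => mem_betaClosure.2 univ_mem

theorem exists_betaClosure_subset {X : Type*} {U : Set (Beta X)} (hU : IsOpen U) {ω : Beta X}
    (hω : ω ∈ U) : ∃ A ∈ ω, betaClosure A ⊆ U := by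
  obtain ⟨_, ⟨A, rfl⟩, hA, hAU⟩ := ultrafilterBasis_is_basis.exists_subset_of_mem_open hω hU
  exact ⟨A, hA, fun u hu => hAU (mem_betaClosure.1 hu)⟩

/-- For the sets whose indicator lies in an ideal, directedness comes from finite unions, so
compactness produces a single set. -/
theorem exists_subset_betaClosure_of_isCompact {X : Type*} {K : Set (Beta X)} (hK : IsCompact K)
    {𝒜 : Set (Set X)} (hne : 𝒜.Nonempty) (hdir : DirectedOn (· ⊆ ·) 𝒜)
    (hcov : K ⊆ ⋃ A ∈ 𝒜, betaClosure A) : ∃ A ∈ 𝒜, K ⊆ betaClosure A := by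
  have := hne.to_subtype
  obtain ⟨⟨A, hA⟩, h⟩ := hK.elim_directed_cover (fun A : 𝒜 => betaClosure (A : Set X))
    (fun A => isOpen_betaClosure _) (by rwa [Set.biUnion_eq_iUnion] at hcov)
    (fun A B => by
      obtain ⟨C, hC, hAC, hBC⟩ := hdir A A.2 B B.2
      exact ⟨⟨C, hC⟩, betaClosure_mono hAC, betaClosure_mono hBC⟩)
  exact ⟨A, hA, h⟩

/-! ### Neighbourhoods of subsets and the coarse groupoid -/

/-- The closed `r`-neighbourhood of a subset of a metric space. -/
def nbhd {X : Type*} [MetricSpace X] (r : ℝ) (A : Set X) : Set X :=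
  {x | ∃ y ∈ A, dist x y ≤ r}

section Groupoid

variable {X : Type*} [MetricSpace X]

theorem mem_coarseGroupoid {γ : Beta (X × X)} :
    γ ∈ coarseGroupoid X ↔ ∃ r : ℝ, 0 < r ∧ entourage X r ∈ γ := by
  simp [coarseGroupoid, mem_betaClosure]

theorem coarseGroupoid_of_entourage_mem {γ : Beta (X × X)} {r : ℝ} (h : entourage X r ∈ γ) :
    γ ∈ coarseGroupoid X :=
  mem_coarseGroupoid.2 ⟨max r 1, lt_max_of_lt_right one_pos,
    mem_of_superset h fun p (hp : dist p.1 p.2 ≤ r) => le_trans hp (le_max_left _ _)⟩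

/-- The inverse of an element of the coarse groupoid. -/
def inverse {X : Type*} (γ : Beta (X × X)) : Beta (X × X) := Ultrafilter.map Prod.swap γ

theorem rangeMap_inverse {X : Type*} (γ : Beta (X × X)) : rangeMap (inverse γ) = sourceMap γ := by
  unfold rangeMap inverse sourceMap
  rw [Ultrafilter.map_map]
  rfl

theorem sourceMap_inverse {X : Type*} (γ : Beta (X × X)) : sourceMap (inverse γ) = rangeMap γ := by
  unfold rangeMap inverse sourceMap
  rw [Ultrafilter.map_map]
  rfl

theorem inverse_mem_coarseGroupoid {γ : Beta (X × X)} (h : γ ∈ coarseGroupoid X) :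
    inverse γ ∈ coarseGroupoid X := by
  obtain ⟨r, hr, hγ⟩ := mem_coarseGroupoid.1 h
  refine mem_coarseGroupoid.2 ⟨r, hr, Ultrafilter.mem_map.2 (mem_of_superset hγ ?_)⟩
  intro p hp
  exact (dist_comm p.2 p.1).trans_le hp

theorem isInvariant_of_forall_sourceMap_mem {U : Set (Beta X)}
    (h : ∀ γ ∈ coarseGroupoid X, sourceMap γ ∈ U → rangeMap γ ∈ U) : IsInvariant U := by
  intro γ hγ
  refine ⟨fun hr => ?_, h γ hγ⟩
  have := h _ (inverse_mem_coarseGroupoid hγ)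
  rw [rangeMap_inverse, sourceMap_inverse] at this
  exact this hr

theorem IsInvariant.compl {U : Set (Beta X)} (h : IsInvariant U) : IsInvariant Uᶜ :=
  fun γ hγ => not_congr (h γ hγ)

theorem nbhd_mem_rangeMap {γ : Beta (X × X)} {r : ℝ} {A : Set X} (h : entourage X r ∈ γ)
    (hA : A ∈ sourceMap γ) : nbhd r A ∈ rangeMap γ := by
  refine Ultrafilter.mem_map.2 (mem_of_superset (inter_mem h (Ultrafilter.mem_map.1 hA)) ?_)
  rintro ⟨x, y⟩ ⟨hd, hy⟩
  exact ⟨y, hy, hd⟩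

/-- The neighbourhood is the first projection of the pairs in the entourage with second coordinate
in A, so ω lifts to an ultrafilter on these pairs. With `nbhd_mem_rangeMap` this turns invariance
into stability under metric neighbourhoods. -/
theorem exists_rangeMap_eq_of_nbhd_mem {ω : Beta X} {r : ℝ} {A : Set X} (h : nbhd r A ∈ ω) :
    ∃ γ ∈ coarseGroupoid X, rangeMap γ = ω ∧ A ∈ sourceMap γ := by
  have h' : Prod.fst '' (entourage X r ∩ Prod.snd ⁻¹' A) ∈ ω := by
    refine mem_of_superset h ?_
    rintro x ⟨y, hy, hd⟩
    exact ⟨(x, y), ⟨hd, hy⟩, rfl⟩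
  have hmem := Ultrafilter.ofComapInfPrincipal_mem h'
  exact ⟨Ultrafilter.ofComapInfPrincipal h',
    coarseGroupoid_of_entourage_mem (mem_of_superset hmem Set.inter_subset_left),
    Ultrafilter.ofComapInfPrincipal_eq_of_map h',
    Ultrafilter.mem_map.2 (mem_of_superset hmem Set.inter_subset_right)⟩

theorem IsInvariant.betaClosure_nbhd_subset {U : Set (Beta X)} (h : IsInvariant U) {A : Set X}
    (hA : betaClosure A ⊆ U) (r : ℝ) : betaClosure (nbhd r A) ⊆ U := by
  intro ω hω
  obtain ⟨γ, hγ, rfl, hs⟩ := exists_rangeMap_eq_of_nbhd_mem (mem_betaClosure.1 hω)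
  exact (h γ hγ).2 (hA (mem_betaClosure.2 hs))

/-- A basic neighbourhood A of the range of γ yields the neighbourhood `nbhd r A` of its source. A
point of Y found there is linked by the groupoid to a point of the closure of A, which lies in Y by
invariance. -/
theorem IsInvariant.closure {Y : Set (Beta X)} (h : IsInvariant Y) : IsInvariant (closure Y) := by
  refine isInvariant_of_forall_sourceMap_mem fun γ hγ hs => ?_
  obtain ⟨r, -, hr⟩ := mem_coarseGroupoid.1 (inverse_mem_coarseGroupoid hγ)
  refine ultrafilterBasis_is_basis.mem_closure_iff.2 ?_
  rintro _ ⟨A, rfl⟩ hA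
  have hn : nbhd r A ∈ sourceMap γ := by
    rw [← rangeMap_inverse]
    exact nbhd_mem_rangeMap hr (by rw [sourceMap_inverse]; exact hA)
  obtain ⟨ω, hω, hωY⟩ := mem_closure_iff.1 hs _ (isOpen_betaClosure _) (mem_betaClosure.2 hn)
  obtain ⟨γ', hγ', rfl, hs'⟩ := exists_rangeMap_eq_of_nbhd_mem (mem_betaClosure.1 hω)
  exact ⟨_, hs', (h γ' hγ').1 hωY⟩

/-! ### Colourings of spaces of bounded geometry -/

/-- In a space of bounded geometry, finitely many colours suffice to give distinct points at
distance at most `r` distinct colours. -/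
theorem BoundedGeometry.exists_coloring (hX : BoundedGeometry X) (r : ℝ) :
    ∃ (n : ℕ) (c : X → Fin n), ∀ x y, dist x y ≤ r → c x = c y → x = y := by
  classical
  -- `BoundedGeometry` concerns positive radii only, hence the maximum with 1.
  obtain ⟨N, hN⟩ := hX (max r 1) (lt_max_of_lt_right one_pos)
  let lt : X → X → Prop := WellOrderingRel
  have wf : WellFounded lt := IsWellFounded.wf
  let used (x : X) (F : (y : X) → lt y x → ℕ) : Set ℕ :=
    {k | ∃ (y : X) (h : lt y x), dist x y ≤ r ∧ F y h = k}
  -- Greedy colouring along a well-order: each point takes the least colour not used by an earlier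
  -- point within distance r. At most N colours are excluded, so N + 1 suffice.
  let c : X → ℕ := wf.fix fun x F => sInf (used x F)ᶜ
  have hc : ∀ x, c x = sInf (used x fun y _ => c y)ᶜ := fun x => wf.fix_eq _ x
  have hcard : ∀ x, (used x fun y _ => c y).encard ≤ N := by
    intro x
    have hsub : (used x fun y _ => c y) ⊆ c '' Metric.closedBall x (max r 1) := by
      rintro k ⟨y, -, hd, rfl⟩
      refine ⟨y, ?_, rfl⟩
      rw [Metric.mem_closedBall, dist_comm]
      exact hd.trans (le_max_left _ _)
    exact (Set.encard_le_encard hsub).trans ((Set.encard_image_le _ _).trans (hN x))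
  have hex : ∀ x, ∃ k ≤ N, k ∈ (used x fun y _ => c y)ᶜ := by
    intro x
    by_contra! hcon
    have hsub : (↑(Finset.range (N + 1)) : Set ℕ) ⊆ used x fun y _ => c y := by
      intro k hk
      have := hcon k (Nat.lt_succ_iff.1 (by simpa using hk))
      simpa using this
    have := (Set.encard_le_encard hsub).trans (hcard x)
    rw [Set.encard_coe_eq_coe_finsetCard, Finset.card_range, Nat.cast_le] at this
    omega
  have hle : ∀ x, c x < N + 1 := by
    intro x
    obtain ⟨k, hk, hmem⟩ := hex x
    rw [hc x]
    exact Nat.lt_succ_of_le ((Nat.sInf_le hmem).trans hk)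
  have hlt : ∀ x y, lt y x → dist x y ≤ r → c x ≠ c y := by
    intro x y h hd he
    obtain ⟨k, -, hmem⟩ := hex x
    have hnot : c x ∈ (used x fun y _ => c y)ᶜ := by
      rw [hc x]
      exact Nat.sInf_mem ⟨k, hmem⟩
    exact hnot ⟨y, h, hd, he.symm⟩
  refine ⟨N + 1, fun x => ⟨c x, hle x⟩, fun x y hd he => ?_⟩
  have he' : c x = c y := congrArg Fin.val he
  rcases trichotomous_of lt x y with h | h | h
  · exact absurd he'.symm (hlt y x h (by rwa [dist_comm]))
  · exact h
  · exact absurd he' (hlt x y h hd)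

theorem BoundedGeometry.finite_closedBall (hX : BoundedGeometry X) (x : X) (r : ℝ) :
    (Metric.closedBall x r).Finite := by
  obtain ⟨N, hN⟩ := hX (max r 1) (lt_max_of_lt_right one_pos)
  refine Set.Finite.subset (Set.encard_lt_top_iff.1 ((hN x).trans_lt ?_))
    (Metric.closedBall_subset_closedBall (le_max_left r 1))
  exact ENat.natCast_lt_top N

/-! ### Limit spaces -/

theorem self_mem_limitSpace (ω : Beta X) : ω ∈ limitSpace ω :=
  ⟨PartialEquiv.refl X, ⟨0, by simp⟩, univ_mem, Ultrafilter.map_id ω⟩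

/-- Every element of a limit space is linked to the base point by an element of the coarse
groupoid. -/
theorem exists_coarseGroupoid_of_mem_limitSpace {ω α : Beta X} (h : α ∈ limitSpace ω) :
    ∃ γ ∈ coarseGroupoid X, rangeMap γ = ω ∧ sourceMap γ = α := by
  obtain ⟨t, ⟨C, hC⟩, hs, rfl⟩ := h
  refine ⟨Ultrafilter.map (fun x => (x, t x)) ω,
    coarseGroupoid_of_entourage_mem (r := C) (Ultrafilter.mem_map.2 (mem_of_superset hs hC)),
    ?_, ?_⟩
  · unfold rangeMap
    rw [Ultrafilter.map_map]
    exact Ultrafilter.map_id ω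
  · unfold sourceMap
    rw [Ultrafilter.map_map]
    rfl

/-- The partial equivalence whose graph is a given single-valued and injective relation. -/
def partialEquivOfGraph {X : Type*} (F : Set (X × X))
    (h₁ : ∀ x y y', (x, y) ∈ F → (x, y') ∈ F → y = y')
    (h₂ : ∀ x x' y, (x, y) ∈ F → (x', y) ∈ F → x = x') : PartialEquiv X X := by
  classical
  exact
  { toFun := fun x => if h : ∃ y, (x, y) ∈ F then h.choose else x
    invFun := fun y => if h : ∃ x, (x, y) ∈ F then h.choose else y
    source := Prod.fst '' F
    target := Prod.snd '' F
    map_source' := by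
      rintro _ ⟨⟨x, y⟩, hp, rfl⟩
      have h : ∃ y, (x, y) ∈ F := ⟨y, hp⟩
      rw [dif_pos h]
      exact ⟨(x, _), h.choose_spec, rfl⟩
    map_target' := by
      rintro _ ⟨⟨x, y⟩, hp, rfl⟩
      have h : ∃ x, (x, y) ∈ F := ⟨x, hp⟩
      rw [dif_pos h]
      exact ⟨(_, y), h.choose_spec, rfl⟩
    left_inv' := by
      rintro _ ⟨⟨x, y⟩, hp, rfl⟩
      have h : ∃ y, (x, y) ∈ F := ⟨y, hp⟩
      have hy : h.choose = y := h₁ _ _ _ h.choose_spec hp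
      have h' : ∃ x, (x, y) ∈ F := ⟨x, hp⟩
      rw [dif_pos h, hy, dif_pos h']
      exact h₂ _ _ _ h'.choose_spec hp
    right_inv' := by
      rintro _ ⟨⟨x, y⟩, hp, rfl⟩
      have h : ∃ x, (x, y) ∈ F := ⟨x, hp⟩
      have hx : h.choose = x := h₂ _ _ _ h.choose_spec hp
      have h' : ∃ y, (x, y) ∈ F := ⟨y, hp⟩
      rw [dif_pos h, hx, dif_pos h']
      exact h₁ _ _ _ h'.choose_spec hp }

theorem partialEquivOfGraph_apply {X : Type*} {F : Set (X × X)}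
    (h₁ : ∀ x y y', (x, y) ∈ F → (x, y') ∈ F → y = y')
    (h₂ : ∀ x x' y, (x, y) ∈ F → (x', y) ∈ F → x = x') {p : X × X} (hp : p ∈ F) :
    partialEquivOfGraph F h₁ h₂ p.1 = p.2 := by
  have h : ∃ y, (p.1, y) ∈ F := ⟨p.2, hp⟩
  exact (dif_pos h).trans (h₁ _ _ _ h.choose_spec hp)

/-- Elements of the coarse groupoid are germs of partial translations. -/
theorem BoundedGeometry.sourceMap_mem_limitSpace (hX : BoundedGeometry X) {γ : Beta (X × X)}
    (hγ : γ ∈ coarseGroupoid X) : sourceMap γ ∈ limitSpace (rangeMap γ) := by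
  obtain ⟨r, -, hr⟩ := mem_coarseGroupoid.1 hγ
  -- Two points within r of a common point are within 2r of each other. The ultrafilter selects one
  -- pair of colours, and on those pairs the relation is single-valued and injective.
  obtain ⟨n, c, hc⟩ := hX.exists_coloring (r + r)
  have hcol : (⋃ q ∈ (Set.univ : Set (Fin n × Fin n)), {p : X × X | (c p.1, c p.2) = q}) ∈ γ := by
    refine mem_of_superset univ_mem fun p _ => ?_
    simp
  obtain ⟨q, -, hq⟩ := (Ultrafilter.finite_biUnion_mem_iff Set.finite_univ).1 hcol
  let F : Set (X × X) := entourage X r ∩ {p : X × X | (c p.1, c p.2) = q}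
  have hF : F ∈ γ := inter_mem hr hq
  have h₁ : ∀ x y y', (x, y) ∈ F → (x, y') ∈ F → y = y' := by
    rintro x y y' ⟨hd, hp⟩ ⟨hd', hp'⟩
    refine hc y y' ((dist_triangle_left y y' x).trans (add_le_add hd hd')) ?_
    exact congrArg Prod.snd (hp.trans hp'.symm)
  have h₂ : ∀ x x' y, (x, y) ∈ F → (x', y) ∈ F → x = x' := by
    rintro x x' y ⟨hd, hp⟩ ⟨hd', hp'⟩
    refine hc x x' ((dist_triangle_right x x' y).trans (add_le_add hd hd')) ?_
    exact congrArg Prod.fst (hp.trans hp'.symm)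
  refine ⟨partialEquivOfGraph F h₁ h₂, ⟨r, ?_⟩, ?_, ?_⟩
  · rintro _ ⟨p, hp, rfl⟩
    rw [partialEquivOfGraph_apply h₁ h₂ hp]
    exact hp.1
  · exact Ultrafilter.mem_map.2 (mem_of_superset hF fun p hp => ⟨p, hp, rfl⟩)
  · unfold rangeMap sourceMap
    rw [Ultrafilter.map_map]
    refine Ultrafilter.coe_injective ?_
    rw [Ultrafilter.coe_map, Ultrafilter.coe_map]
    refine Filter.map_congr (mem_of_superset hF fun p hp => ?_)
    exact partialEquivOfGraph_apply h₁ h₂ hp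

theorem limitSpace_trans {ω α β : Beta X} (h : α ∈ limitSpace ω) (h' : β ∈ limitSpace α) :
    β ∈ limitSpace ω := by
  obtain ⟨t, ⟨C, hC⟩, hs, rfl⟩ := h
  obtain ⟨t', ⟨C', hC'⟩, hs', rfl⟩ := h'
  refine ⟨t.trans t', ⟨C + C', ?_⟩, ?_, ?_⟩
  · rintro x hx
    rw [PartialEquiv.trans_source] at hx
    exact (dist_triangle x (t x) _).trans (add_le_add (hC x hx.1) (hC' _ hx.2))
  · rw [PartialEquiv.trans_source]
    exact inter_mem hs (Ultrafilter.mem_map.1 hs')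
  · rw [Ultrafilter.map_map]
    rfl

theorem BoundedGeometry.isInvariant_limitSpace (hX : BoundedGeometry X) (ω : Beta X) :
    IsInvariant (limitSpace ω) := by
  refine isInvariant_of_forall_sourceMap_mem fun γ hγ hs => ?_
  refine limitSpace_trans hs ?_
  have := hX.sourceMap_mem_limitSpace (inverse_mem_coarseGroupoid hγ)
  rwa [rangeMap_inverse, sourceMap_inverse] at this

theorem limitSpace_subset_of_mem {Y : Set (Beta X)} (hY : IsInvariant Y) {ω : Beta X}
    (hω : ω ∈ Y) : limitSpace ω ⊆ Y := by
  intro α hα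
  obtain ⟨γ, hγ, rfl, rfl⟩ := exists_coarseGroupoid_of_mem_limitSpace hα
  exact (hY γ hγ).1 hω

/-! ### The Stone-Čech boundary -/

theorem isClosed_boundary {X : Type*} : IsClosed (boundary X) := by
  have h : Set.range (pure : X → Beta X) = ⋃ x : X, betaClosure {x} := by
    ext ω
    rw [Set.mem_iUnion]
    constructor
    · rintro ⟨x, rfl⟩
      exact ⟨x, mem_betaClosure.2 (Set.mem_singleton x)⟩
    · rintro ⟨x, hx⟩
      obtain ⟨y, -, rfl⟩ :=
        Ultrafilter.eq_pure_of_finite_mem (Set.finite_singleton x) (mem_betaClosure.1 hx)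
      exact ⟨y, rfl⟩
  refine isClosed_compl_iff.2 ?_
  rw [h]
  exact isOpen_iUnion fun x => isOpen_betaClosure _

theorem boundary_nonempty {X : Type*} [Infinite X] : (boundary X).Nonempty := by
  refine ⟨hyperfilter X, ?_⟩
  rintro ⟨x, hx⟩
  have h : ({x} : Set X) ∈ hyperfilter X := hx ▸ (Set.mem_singleton x : {x} ∈ (pure x : Beta X))
  exact notMem_hyperfilter_of_finite (Set.finite_singleton x) h

/-- If the source is principal at x, the range contains a finite ball around x and is therefore
principal. -/
theorem BoundedGeometry.isInvariant_boundary (hX : BoundedGeometry X) :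
    IsInvariant (boundary X) := by
  have h : IsInvariant (Set.range (pure : X → Beta X)) := by
    refine isInvariant_of_forall_sourceMap_mem ?_
    rintro γ hγ ⟨x, hx⟩
    obtain ⟨r, -, hr⟩ := mem_coarseGroupoid.1 hγ
    have hs : ({x} : Set X) ∈ sourceMap γ :=
      hx ▸ (Set.mem_singleton x : {x} ∈ (pure x : Beta X))
    have hfin : (nbhd r ({x} : Set X)).Finite := by
      refine (hX.finite_closedBall x r).subset ?_
      rintro y ⟨_, rfl, hd⟩
      exact hd
    obtain ⟨y, -, hy⟩ := Ultrafilter.eq_pure_of_finite_mem hfin (nbhd_mem_rangeMap hr hs)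
    exact ⟨y, hy.symm⟩
  exact h.compl

/-- Any two points of X are at finite distance, so X is a single orbit, and it is dense in βX. -/
theorem eq_univ_of_pure_mem {K : Set (Beta X)} (hK : IsClosed K) (hinv : IsInvariant K) {x : X}
    (hx : (pure x : Beta X) ∈ K) : K = Set.univ := by
  refine Set.eq_univ_of_univ_subset ?_
  rw [← denseRange_pure.closure_range]
  refine closure_minimal ?_ hK
  rintro _ ⟨y, rfl⟩
  have h := hinv (pure (x, y)) (coarseGroupoid_of_entourage_mem (r := dist x y)
    (show (x, y) ∈ entourage X (dist x y) from le_refl (dist x y)))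
  unfold rangeMap sourceMap at h
  rw [Ultrafilter.map_pure, Ultrafilter.map_pure] at h
  exact h.1 hx

theorem BoundedGeometry.subset_boundary_of_isMinimalInvariantClosed [Infinite X]
    (hX : BoundedGeometry X) {K : Set (Beta X)} (hK : IsMinimalInvariantClosed K) :
    K ⊆ boundary X := by
  obtain ⟨⟨hcl, hinv⟩, -, hmin⟩ := hK
  rintro _ hω ⟨x, rfl⟩
  have huniv := eq_univ_of_pure_mem hcl hinv hω
  refine hmin (boundary X) isClosed_boundary hX.isInvariant_boundary boundary_nonempty.ne_empty ?_
  rw [huniv, Set.ssubset_univ_iff]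
  intro h
  have : (pure x : Beta X) ∈ boundary X := h ▸ Set.mem_univ _
  exact this ⟨x, rfl⟩

theorem BoundedGeometry.eq_closure_limitSpace (hX : BoundedGeometry X) {K : Set (Beta X)}
    (hK : IsMinimalInvariantClosed K) {ω : Beta X} (hω : ω ∈ K) : K = closure (limitSpace ω) := by
  obtain ⟨⟨hcl, hinv⟩, -, hmin⟩ := hK
  have hsub : closure (limitSpace ω) ⊆ K :=
    closure_minimal (limitSpace_subset_of_mem hinv hω) hcl
  by_contra hne
  refine hmin _ isClosed_closure (hX.isInvariant_limitSpace ω).closure ?_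
    (hsub.ssubset_of_ne (Ne.symm hne))
  exact Set.Nonempty.ne_empty ⟨ω, subset_closure (self_mem_limitSpace ω)⟩

theorem BoundedGeometry.exists_isMinimalPoint [Infinite X] (hX : BoundedGeometry X)
    {K : Set (Beta X)} (hK : IsMinimalInvariantClosed K) :
    ∃ ω ∈ boundary X, IsMinimalPoint ω ∧ K = closure (limitSpace ω) := by
  obtain ⟨ω, hω⟩ := Set.nonempty_iff_ne_empty.2 hK.2.1
  have hb := hX.subset_boundary_of_isMinimalInvariantClosed hK hω
  have he := hX.eq_closure_limitSpace hK hω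
  exact ⟨ω, hb, ⟨hb, he ▸ hK⟩, he⟩

theorem isMinimalInvariantClosed_compl_iff {U : Set (Beta X)} :
    IsMinimalInvariantClosed Uᶜ ↔ IsMaximalInvariantOpen U := by
  constructor
  · rintro ⟨⟨h₁, h₂⟩, h₃, h₄⟩
    refine ⟨⟨isClosed_compl_iff.1 h₁, by simpa using h₂.compl⟩, fun h => h₃ (by simp [h]), ?_⟩
    intro V hV hVi hVu hUV
    refine h₄ Vᶜ hV.isClosed_compl hVi.compl (fun h => hVu (Set.compl_empty_iff.1 h)) ?_
    exact compl_lt_compl_iff_lt.2 hUV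
  · rintro ⟨⟨h₁, h₂⟩, h₃, h₄⟩
    refine ⟨⟨h₁.isClosed_compl, h₂.compl⟩, fun h => h₃ (Set.compl_empty_iff.1 h), ?_⟩
    intro L hL hLi hLe hLU
    refine h₄ Lᶜ hL.isOpen_compl hLi.compl (fun h => hLe (Set.compl_univ_iff.1 h)) ?_
    exact compl_lt_compl_iff_lt.1 (by rwa [compl_compl])

end Groupoid

/-! ### Matrix coefficients of operators -/

section Coefficients

variable {X : Type*}

theorem delta_apply_self (x : X) : (delta x : L2 X) x = 1 := by
  classical
  have h : delta x = lp.single 2 x (1 : ℂ) := by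
    unfold delta; congr!
  rw [h]
  exact lp.single_apply_self (E := fun _ : X => ℂ) 2 x (1 : ℂ)

theorem norm_delta (x : X) : ‖delta x‖ = 1 := by
  classical
  have h : delta x = lp.single 2 x (1 : ℂ) := by
    unfold delta; congr!
  rw [h, lp.norm_single (by norm_num), norm_one]

theorem norm_coeff_le (T : L2 X →L[ℂ] L2 X) (x y : X) : ‖coeff T x y‖ ≤ ‖T‖ := by
  refine (lp.norm_apply_le_norm two_ne_zero (T (delta y)) x).trans ?_
  simpa [norm_delta] using T.le_opNorm (delta y)

theorem coeff_add (S T : L2 X →L[ℂ] L2 X) (x y : X) :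
    coeff (S + T) x y = coeff S x y + coeff T x y := rfl

theorem coeff_neg (T : L2 X →L[ℂ] L2 X) (x y : X) : coeff (-T) x y = -coeff T x y := rfl

theorem coeff_sub (S T : L2 X →L[ℂ] L2 X) (x y : X) :
    coeff (S - T) x y = coeff S x y - coeff T x y := rfl

theorem coeff_zero (x y : X) : coeff (0 : L2 X →L[ℂ] L2 X) x y = 0 := rfl

theorem hasSum_smul_delta (h : L2 X) : HasSum (fun z => h z • delta z) h := by
  classical
  have h1 : HasSum (fun z : X => lp.single (E := fun _ : X => ℂ) 2 z (h z)) h :=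
    lp.hasSum_single (by simp) _
  convert h1 using 2 with z
  have h' : delta z = lp.single (E := fun _ : X => ℂ) 2 z (1 : ℂ) := by
    unfold delta; congr!
  rw [h', ← lp.single_smul]
  simp

theorem hasSum_apply (S : L2 X →L[ℂ] L2 X) (h : L2 X) (x : X) :
    HasSum (fun z => coeff S x z * h z) (S h x) := by
  have h2 := ((hasSum_smul_delta h).mapL S).mapL (innerSL ℂ (delta x))
  rw [innerSL_apply_apply, inner_delta] at h2
  have h3 : (fun z => coeff S x z * h z)
      = fun z => innerSL ℂ (delta x) (S (h z • delta z)) := by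
    funext z
    rw [map_smul, map_smul, innerSL_apply_apply, inner_delta, smul_eq_mul, mul_comm]
    rfl
  rw [h3]
  exact h2

theorem hasSum_coeff_mul (S T : L2 X →L[ℂ] L2 X) (x y : X) :
    HasSum (fun z => coeff S x z * coeff T z y) (coeff (S * T) x y) :=
  hasSum_apply S (T (delta y)) x

theorem ext_coeff {S T : L2 X →L[ℂ] L2 X} (h : ∀ x y, coeff S x y = coeff T x y) : S = T := by
  ext f x
  refine (hasSum_apply S f x).unique ?_
  simpa only [h] using hasSum_apply T f x

/-- If only few terms contribute to a coefficient of a product, then one of them is large. -/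
theorem exists_le_mul_norm_coeff {S T : L2 X →L[ℂ] L2 X} {x y : X} {F : Set X} {N : ℕ}
    (hF : F.encard ≤ N) (hST : ∀ z, coeff S x z ≠ 0 → coeff T z y ≠ 0 → z ∈ F) {δ : ℝ}
    (hδ : 0 < δ) (h : δ ≤ ‖coeff (S * T) x y‖) :
    ∃ z ∈ F, δ ≤ N * (‖coeff S x z‖ * ‖coeff T z y‖) := by
  have hfin : F.Finite := Set.encard_lt_top_iff.1 (hF.trans_lt (ENat.natCast_lt_top N))
  have hsum : coeff (S * T) x y = ∑ z ∈ hfin.toFinset, coeff S x z * coeff T z y := by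
    refine (hasSum_coeff_mul S T x y).unique (hasSum_sum_of_ne_finset_zero fun z hz => ?_)
    by_contra hne
    exact hz (hfin.mem_toFinset.2 (hST z (left_ne_zero_of_mul hne) (right_ne_zero_of_mul hne)))
  have hcard : (hfin.toFinset.card : ℝ) ≤ N := by
    rw [hfin.encard_eq_coe_toFinset_card, Nat.cast_le] at hF
    exact_mod_cast hF
  by_contra! hcon
  have hne : hfin.toFinset.Nonempty := by
    rw [Finset.nonempty_iff_ne_empty]
    intro he
    rw [hsum, he, Finset.sum_empty, norm_zero] at h
    exact h.not_gt hδ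
  have h1 : δ ≤ ∑ z ∈ hfin.toFinset, ‖coeff S x z‖ * ‖coeff T z y‖ := by
    refine h.trans ?_
    rw [hsum]
    refine (norm_sum_le _ _).trans (Finset.sum_le_sum fun z _ => (norm_mul _ _).le)
  -- If every term times N were below δ, summation over F would give Nδ < |F|δ, against |F| ≤ N.
  have h2 : (N : ℝ) * δ < hfin.toFinset.card * δ := by
    refine (mul_le_mul_of_nonneg_left h1 N.cast_nonneg).trans_lt ?_
    rw [Finset.mul_sum, ← nsmul_eq_mul, ← Finset.sum_const]
    exact Finset.sum_lt_sum_of_nonempty hne fun z hz => hcon z (hfin.mem_toFinset.1 hz)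
  exact absurd (lt_of_mul_lt_mul_right h2 hδ.le) hcard.not_gt

/-! ### Weighted composition operators -/

/-- Terms with f x ≠ 0 sample h at distinct points, so their squares are dominated by C² times a
partial sum of ‖h‖². -/
theorem sum_sq_weightedComp_le {f : X → ℂ} {g : X → X} {C : ℝ} (hC : 0 ≤ C)
    (hf : ∀ x, ‖f x‖ ≤ C) (hg : Set.InjOn g (Function.support f)) (h : L2 X) (s : Finset X) :
    ∑ x ∈ s, ‖f x * h (g x)‖ ^ (2 : ENNReal).toReal ≤ (C * ‖h‖) ^ (2 : ENNReal).toReal := by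
  classical
  have hp : 0 < (2 : ENNReal).toReal := by norm_num
  have h1 : ∑ x ∈ s, ‖f x * h (g x)‖ ^ (2 : ENNReal).toReal
      = ∑ x ∈ s with f x ≠ 0, ‖f x * h (g x)‖ ^ (2 : ENNReal).toReal := by
    refine (Finset.sum_filter_of_ne fun x _ hx => ?_).symm
    intro h0
    exact hx (by rw [h0, zero_mul, norm_zero, Real.zero_rpow hp.ne'])
  have hinj : Set.InjOn g (↑(s.filter fun x => f x ≠ 0) : Set X) :=
    hg.mono fun x hx => (Finset.mem_filter.1 hx).2
  rw [h1]
  calc ∑ x ∈ s with f x ≠ 0, ‖f x * h (g x)‖ ^ (2 : ENNReal).toReal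
      ≤ ∑ x ∈ s with f x ≠ 0,
          C ^ (2 : ENNReal).toReal * ‖h (g x)‖ ^ (2 : ENNReal).toReal := by
        refine Finset.sum_le_sum fun x _ => ?_
        rw [norm_mul, Real.mul_rpow (norm_nonneg _) (norm_nonneg _)]
        exact mul_le_mul_of_nonneg_right (Real.rpow_le_rpow (norm_nonneg _) (hf x) hp.le)
          (Real.rpow_nonneg (norm_nonneg _) _)
    _ = C ^ (2 : ENNReal).toReal *
          ∑ z ∈ (s.filter fun x => f x ≠ 0).image g, ‖h z‖ ^ (2 : ENNReal).toReal := by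
        rw [← Finset.mul_sum, Finset.sum_image hinj]
    _ ≤ C ^ (2 : ENNReal).toReal * ‖h‖ ^ (2 : ENNReal).toReal :=
        mul_le_mul_of_nonneg_left (lp.sum_rpow_le_norm_rpow hp h _) (Real.rpow_nonneg hC _)
    _ = (C * ‖h‖) ^ (2 : ENNReal).toReal := (Real.mul_rpow hC (norm_nonneg _)).symm

/-- Composition with a function that is injective on the support of a bounded weight is a bounded
operator on `ℓ²(X)`. -/
theorem exists_weightedComp {f : X → ℂ} {g : X → X} {C : ℝ} (hC : 0 ≤ C)
    (hf : ∀ x, ‖f x‖ ≤ C) (hg : Set.InjOn g (Function.support f)) :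
    ∃ P : L2 X →L[ℂ] L2 X, ‖P‖ ≤ C ∧ ∀ (h : L2 X) (x : X), P h x = f x * h (g x) := by
  let L : L2 X →ₗ[ℂ] L2 X :=
    { toFun := fun h =>
        ⟨fun x => f x * h (g x), memℓp_gen' fun s => sum_sq_weightedComp_le hC hf hg h s⟩
      map_add' := by
        intro h k
        ext x
        exact mul_add (f x) (h (g x)) (k (g x))
      map_smul' := by
        intro c h
        ext x
        exact mul_left_comm (f x) c (h (g x)) }
  refine ⟨L.mkContinuous C fun h => ?_, LinearMap.mkContinuous_norm_le _ hC _, fun h x => rfl⟩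
  exact lp.norm_le_of_forall_sum_le (by norm_num) (mul_nonneg hC (norm_nonneg _))
    fun s => sum_sq_weightedComp_le hC hf hg h s

theorem norm_indicator_one_le (A : Set X) (x : X) : ‖A.indicator (1 : X → ℂ) x‖ ≤ 1 := by
  by_cases hx : x ∈ A <;> simp [hx]

/-- The multiplication operator by the indicator function of a subset. -/
def indicatorOp (A : Set X) : L2 X →L[ℂ] L2 X :=
  (exists_weightedComp (g := id) zero_le_one (norm_indicator_one_le A)
    Function.injective_id.injOn).choose

theorem norm_indicatorOp_le (A : Set X) : ‖indicatorOp A‖ ≤ 1 :=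
  (exists_weightedComp (g := id) zero_le_one (norm_indicator_one_le A)
    Function.injective_id.injOn).choose_spec.1

theorem indicatorOp_apply (A : Set X) (h : L2 X) (x : X) :
    indicatorOp A h x = A.indicator (1 : X → ℂ) x * h x :=
  (exists_weightedComp (g := id) zero_le_one (norm_indicator_one_le A)
    Function.injective_id.injOn).choose_spec.2 h x

theorem coeff_indicatorOp (A : Set X) (x y : X) :
    coeff (indicatorOp A) x y = A.indicator (1 : X → ℂ) x * (delta y : L2 X) x :=
  indicatorOp_apply A (delta y) x

theorem coeff_indicatorOp_mul (A : Set X) (T : L2 X →L[ℂ] L2 X) (x y : X) :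
    coeff (indicatorOp A * T) x y = A.indicator (1 : X → ℂ) x * coeff T x y :=
  indicatorOp_apply A (T (delta y)) x

theorem indicatorOp_mul_indicatorOp (A B : Set X) :
    indicatorOp A * indicatorOp B = indicatorOp (A ∩ B) := by
  refine ext_coeff fun x y => ?_
  rw [coeff_indicatorOp_mul, coeff_indicatorOp, coeff_indicatorOp, ← mul_assoc,
    Set.inter_indicator_one]
  rfl

theorem indicatorOp_union_of_disjoint {A B : Set X} (h : Disjoint A B) :
    indicatorOp (A ∪ B) = indicatorOp A + indicatorOp B := by
  refine ext_coeff fun x y => ?_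
  rw [coeff_add, coeff_indicatorOp, coeff_indicatorOp, coeff_indicatorOp, ← add_mul,
    Set.indicator_union_of_disjoint h]

theorem indicatorOp_univ : indicatorOp (Set.univ : Set X) = 1 := by
  refine ext_coeff fun x y => ?_
  rw [coeff_indicatorOp, Set.indicator_univ, Pi.one_apply, one_mul]
  rfl

theorem fst_image_epsSupport_indicatorOp_subset (A : Set X) {ε : ℝ} (hε : 0 < ε) :
    Prod.fst '' epsSupport (indicatorOp A) ε ⊆ A := by
  rintro _ ⟨⟨x, y⟩, hp, rfl⟩
  by_contra hx
  have hp' : ε ≤ ‖coeff (indicatorOp A) x y‖ := hp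
  rw [coeff_indicatorOp, Set.indicator_of_notMem hx, zero_mul, norm_zero] at hp'
  exact hp'.not_gt hε

theorem subset_fst_image_epsSupport_indicatorOp (A : Set X) :
    A ⊆ Prod.fst '' epsSupport (indicatorOp A) 1 := by
  intro x hx
  refine ⟨(x, x), ?_, rfl⟩
  show (1 : ℝ) ≤ ‖coeff (indicatorOp A) x x‖
  rw [coeff_indicatorOp, Set.indicator_of_mem hx, delta_apply_self]
  simp

end Coefficients

/-! ### Operators in the uniform Roe algebra -/

section Algebra

variable {X : Type*} [MetricSpace X]

theorem FinitePropagation.mem_uniformRoeAlgebra {T : L2 X →L[ℂ] L2 X} (h : FinitePropagation T) :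
    T ∈ uniformRoeAlgebra X :=
  (algebraicUniformRoeAlgebra X).le_topologicalClosure h

theorem exists_finitePropagation_norm_sub_lt {T : L2 X →L[ℂ] L2 X} (h : T ∈ uniformRoeAlgebra X)
    {δ : ℝ} (hδ : 0 < δ) : ∃ S, FinitePropagation S ∧ ‖T - S‖ < δ := by
  have h' : T ∈ closure (algebraicUniformRoeAlgebra X : Set (L2 X →L[ℂ] L2 X)) := h
  obtain ⟨S, hS, hd⟩ := Metric.mem_closure_iff.1 h' δ hδ
  exact ⟨S, hS, by rwa [← dist_eq_norm]⟩

theorem finitePropagation_of_forall_apply_eq {P : L2 X →L[ℂ] L2 X} {f : X → ℂ} {g : X → X} {R : ℝ}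
    (hP : ∀ (h : L2 X) (x : X), P h x = f x * h (g x)) (hR : ∀ x, f x ≠ 0 → dist x (g x) ≤ R) :
    FinitePropagation P := by
  refine ⟨R, fun x y hxy => ?_⟩
  have h : coeff P x y = f x * (delta y : L2 X) (g x) := hP _ _
  rw [h] at hxy
  have hy : g x = y := by
    by_contra hne
    exact right_ne_zero_of_mul hxy (delta_apply_of_ne hne)
  exact hy ▸ hR x (left_ne_zero_of_mul hxy)

theorem finitePropagation_indicatorOp (A : Set X) : FinitePropagation (indicatorOp A) :=
  finitePropagation_of_forall_apply_eq (g := id) (R := 0) (indicatorOp_apply A) fun x _ => by simp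

/-- The indicator function of a subset as an element of the uniform Roe algebra. -/
def indicatorElem (A : Set X) : uniformRoeAlgebra X :=
  ⟨indicatorOp A, (finitePropagation_indicatorOp A).mem_uniformRoeAlgebra⟩

theorem indicatorElem_mul_indicatorElem (A B : Set X) :
    indicatorElem A * indicatorElem B = indicatorElem (A ∩ B) :=
  Subtype.ext (indicatorOp_mul_indicatorOp A B)

theorem indicatorElem_union_of_disjoint {A B : Set X} (h : Disjoint A B) :
    indicatorElem (A ∪ B) = indicatorElem A + indicatorElem B :=
  Subtype.ext (indicatorOp_union_of_disjoint h)

theorem indicatorElem_univ : indicatorElem (Set.univ : Set X) = 1 :=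
  Subtype.ext indicatorOp_univ

end Algebra

/-! ### Closed ideals -/

/-- A closed two-sided ideal contains every idempotent at distance less than `1` from it. -/
theorem _root_.TwoSidedIdeal.mem_of_isIdempotentElem_of_norm_sub_lt_one {R : Type*} [NormedRing R]
    {J : TwoSidedIdeal R} (hJ : IsClosed (J : Set R)) {p q : R} (hp : IsIdempotentElem p)
    (hq : q ∈ J) (h : ‖p - q‖ < 1) : p ∈ J := by
  -- Modulo J the element p - q equals the idempotent p, and so do its powers; in norm these powers
  -- tend to 0.
  have hmem : ∀ n : ℕ, p - (p - q) ^ (n + 1) ∈ J := by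
    intro n
    induction n with
    | zero => simpa using hq
    | succ n ih =>
      have he : p - (p - q) ^ (n + 1 + 1)
          = (p - (p - q) ^ (n + 1)) * p + (p - q) ^ (n + 1) * q := by
        rw [pow_succ _ (n + 1), sub_mul, mul_sub, hp.eq]
        abel
      rw [he]
      exact J.add_mem (J.mul_mem_right _ _ ih) (J.mul_mem_left _ _ hq)
  have hlim : Tendsto (fun n : ℕ => p - (p - q) ^ (n + 1)) atTop (𝓝 (p - 0)) :=
    tendsto_const_nhds.sub
      ((tendsto_pow_atTop_nhds_zero_of_norm_lt_one h).comp (tendsto_add_atTop_nat 1))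
  rw [sub_zero] at hlim
  exact hJ.mem_of_tendsto hlim (Eventually.of_forall hmem)

section Ideals

variable {X : Type*} [MetricSpace X] {J : TwoSidedIdeal (uniformRoeAlgebra X)}

theorem indicatorElem_mem_of_subset {A B : Set X} (hA : indicatorElem A ∈ J) (h : B ⊆ A) :
    indicatorElem B ∈ J := by
  rw [← Set.inter_eq_self_of_subset_left h, ← indicatorElem_mul_indicatorElem]
  exact J.mul_mem_left _ _ hA

theorem indicatorElem_union_mem {A B : Set X} (hA : indicatorElem A ∈ J)
    (hB : indicatorElem B ∈ J) : indicatorElem (A ∪ B) ∈ J := by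
  rw [← Set.union_sdiff_self, indicatorElem_union_of_disjoint Set.disjoint_sdiff_right]
  exact J.add_mem hA (indicatorElem_mem_of_subset hB Set.sdiff_subset)

theorem indicatorElem_empty_mem : indicatorElem (∅ : Set X) ∈ J := by
  have h := indicatorElem_union_of_disjoint (Set.disjoint_empty (∅ : Set X))
  rw [Set.union_empty] at h
  rw [left_eq_add.1 h]
  exact J.zero_mem

/-- This reduces membership to one colour class, where points are far enough apart for partial
translations to exist. -/
theorem indicatorElem_mem_of_forall_color {n : ℕ} (c : X → Fin n) {A : Set X}
    (h : ∀ k, indicatorElem (A ∩ c ⁻¹' {k}) ∈ J) : indicatorElem A ∈ J := by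
  classical
  have hs : ∀ s : Finset (Fin n), indicatorElem (A ∩ c ⁻¹' s) ∈ J := by
    intro s
    induction s using Finset.induction_on with
    | empty => simpa using indicatorElem_empty_mem
    | insert k s _ ih =>
      rw [Finset.coe_insert, Set.insert_eq, Set.preimage_union, Set.inter_union_distrib_left]
      exact indicatorElem_union_mem (h k) ih
  simpa using hs Finset.univ

/-- The projection onto the range of the `ε`-support of an element of a closed ideal belongs to the
ideal. -/
theorem BoundedGeometry.indicatorElem_fst_image_epsSupport_mem (hX : BoundedGeometry X)
    (hJ : IsClosed (J : Set (uniformRoeAlgebra X))) {T : uniformRoeAlgebra X} (hT : T ∈ J) {ε : ℝ}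
    (hε : 0 < ε) :
    indicatorElem (Prod.fst '' epsSupport (T : L2 X →L[ℂ] L2 X) ε) ∈ J := by
  classical
  set A : Set X := Prod.fst '' epsSupport (T : L2 X →L[ℂ] L2 X) ε
  -- With error ε/4, every row in A keeps an entry of S of size at least ε/2. The weights below are
  -- then at most 2/ε, and the final error is (ε/4)(2/ε) = 1/2 < 1.
  obtain ⟨S, ⟨R, hR⟩, hTS⟩ := exists_finitePropagation_norm_sub_lt T.2 (by positivity : 0 < ε / 4)
  have hex : ∀ x, ∃ y, x ∈ A → ε / 2 ≤ ‖coeff S x y‖ := by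
    intro x
    by_cases hx : x ∈ A
    · obtain ⟨⟨x, y⟩, hp, rfl⟩ := hx
      refine ⟨y, fun _ => ?_⟩
      have hp' : ε ≤ ‖coeff (T : L2 X →L[ℂ] L2 X) x y‖ := hp
      have h1 := (norm_coeff_le ((T : L2 X →L[ℂ] L2 X) - S) x y).trans hTS.le
      rw [coeff_sub] at h1
      have h2 := norm_sub_norm_le (coeff (T : L2 X →L[ℂ] L2 X) x y) (coeff S x y)
      show ε / 2 ≤ ‖coeff S x y‖
      linarith
    · exact ⟨x, fun h => absurd h hx⟩
  choose g hg using hex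
  have hne : ∀ x ∈ A, coeff S x (g x) ≠ 0 := fun x hx h0 => by
    have := hg x hx
    rw [h0, norm_zero] at this
    linarith
  -- Rows of S that meet a common column are within 2R of each other. Within one colour class, the
  -- chosen column g x' thus meets S in row x' alone.
  obtain ⟨n, c, hc⟩ := hX.exists_coloring (R + R)
  refine indicatorElem_mem_of_forall_color c fun k => ?_
  set B : Set X := A ∩ c ⁻¹' {k}
  have hsep : ∀ x ∈ B, ∀ x' ∈ B, dist x (g x') ≤ R → x = x' := by
    intro x hx x' hx' hd
    refine hc x x' ((dist_triangle_right x x' (g x')).trans (add_le_add hd ?_))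
      (hx.2.trans hx'.2.symm)
    exact hR _ _ (hne x' hx'.1)
  -- The adjoint of P sends δ_y to the conjugate of f y times δ_{g y}, so this weight makes the
  -- diagonal entry of S P* equal to 1 at each y ∈ B.
  let f : X → ℂ := fun x => if x ∈ B then star (coeff S x (g x))⁻¹ else 0
  have hfB : ∀ x, f x ≠ 0 → x ∈ B := fun x hx => by
    by_contra h
    exact hx (if_neg h)
  have hf : ∀ x, ‖f x‖ ≤ 2 / ε := by
    intro x
    by_cases hx : x ∈ B
    · have he : f x = star (coeff S x (g x))⁻¹ := if_pos hx
      rw [he, norm_star, norm_inv, ← inv_div ε 2]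
      exact inv_anti₀ (by positivity) (hg x hx.1)
    · have he : f x = 0 := if_neg hx
      rw [he, norm_zero]
      positivity
  have hinj : Set.InjOn g (Function.support f) := by
    intro x hx x' hx' he
    refine hsep x (hfB x hx) x' (hfB x' hx') ?_
    rw [← he]
    exact hR _ _ (hne x (hfB x hx).1)
  obtain ⟨P, hPn, hP⟩ := exists_weightedComp (by positivity) hf hinj
  have hPfin : FinitePropagation P :=
    finitePropagation_of_forall_apply_eq hP fun x hx => hR _ _ (hne x (hfB x hx).1)
  let W : uniformRoeAlgebra X := star ⟨P, hPfin.mem_uniformRoeAlgebra⟩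
  have hW : ∀ z y, coeff (star P) z y = star (f y * (delta z : L2 X) (g y)) := by
    intro z y
    rw [coeff_adjoint]
    exact congrArg star (hP _ _)
  have hSW : ∀ x y, coeff (S * star P) x y = coeff S x (g y) * star (f y) := by
    intro x y
    refine (hasSum_coeff_mul S (star P) x y).unique ?_
    have h1 : coeff S x (g y) * star (f y) = coeff S x (g y) * coeff (star P) (g y) y := by
      rw [hW, delta_apply_self, mul_one]
    rw [h1]
    refine hasSum_single (g y) fun z hz => ?_
    rw [hW, delta_apply_of_ne hz.symm, mul_zero, star_zero, mul_zero]
  -- In the rows of B, off-diagonal entries vanish: by separation for columns in B, and because f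
  -- vanishes for the others.
  have hBSW : indicatorOp B * (S * star P) = indicatorOp B := by
    refine ext_coeff fun x y => ?_
    rw [coeff_indicatorOp_mul, coeff_indicatorOp, hSW]
    by_cases hx : x ∈ B
    · congr 1
      by_cases hy : y ∈ B
      · have he : f y = star (coeff S y (g y))⁻¹ := if_pos hy
        rw [he, star_star]
        by_cases hxy : x = y
        · rw [hxy, delta_apply_self, mul_inv_cancel₀ (hne y hy.1)]
        · rw [delta_apply_of_ne hxy]
          by_cases h0 : coeff S x (g y) = 0
          · rw [h0, zero_mul]
          · exact absurd (hsep x hx y hy (hR _ _ h0)) hxy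
      · have he : f y = 0 := if_neg hy
        rw [he, star_zero, mul_zero, delta_apply_of_ne]
        rintro rfl
        exact hy hx
    · rw [Set.indicator_of_notMem hx, zero_mul, zero_mul]
  refine TwoSidedIdeal.mem_of_isIdempotentElem_of_norm_sub_lt_one hJ
    (q := indicatorElem B * (T * W)) ?_ (J.mul_mem_left _ _ (J.mul_mem_right _ _ hT)) ?_
  · unfold IsIdempotentElem
    rw [indicatorElem_mul_indicatorElem, Set.inter_self]
  · show ‖indicatorOp B - indicatorOp B * ((T : L2 X →L[ℂ] L2 X) * star P)‖ < 1
    have he : indicatorOp B - indicatorOp B * ((T : L2 X →L[ℂ] L2 X) * star P)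
        = -(indicatorOp B * (((T : L2 X →L[ℂ] L2 X) - S) * star P)) := by
      rw [sub_mul, mul_sub, hBSW, neg_sub]
    rw [he, norm_neg]
    calc ‖indicatorOp B * (((T : L2 X →L[ℂ] L2 X) - S) * star P)‖
        ≤ ‖indicatorOp B‖ * (‖(T : L2 X →L[ℂ] L2 X) - S‖ * ‖star P‖) :=
          (norm_mul_le _ _).trans (mul_le_mul_of_nonneg_left (norm_mul_le _ _) (norm_nonneg _))
      _ ≤ 1 * (ε / 4 * (2 / ε)) := by
          have hn : ‖star P‖ = ‖P‖ := LinearIsometryEquiv.norm_map ContinuousLinearMap.adjoint P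
          rw [hn]
          gcongr
          exact norm_indicatorOp_le B
      _ = 1 / 2 := by field_simp; norm_num
      _ < 1 := by norm_num

/-- On a colour class B of the neighbourhood, moving each point to a nearby point of A is injective.
The resulting operator P satisfies P χ_A = P, so it lies in J, and its 1-support projects onto a set
containing B. -/
theorem BoundedGeometry.indicatorElem_nbhd_mem (hX : BoundedGeometry X)
    (hJ : IsClosed (J : Set (uniformRoeAlgebra X))) {A : Set X} (hA : indicatorElem A ∈ J) (r : ℝ) :
    indicatorElem (nbhd r A) ∈ J := by
  classical
  have hex : ∀ x, ∃ y, x ∈ nbhd r A → y ∈ A ∧ dist x y ≤ r := by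
    intro x
    by_cases hx : x ∈ nbhd r A
    · obtain ⟨y, hy⟩ := hx
      exact ⟨y, fun _ => hy⟩
    · exact ⟨x, fun h => absurd h hx⟩
  choose g hg using hex
  obtain ⟨n, c, hc⟩ := hX.exists_coloring (r + r)
  refine indicatorElem_mem_of_forall_color c fun k => ?_
  set B : Set X := nbhd r A ∩ c ⁻¹' {k}
  have hsupp : ∀ x, B.indicator (1 : X → ℂ) x ≠ 0 → x ∈ B := fun x hx =>
    Set.mem_of_indicator_ne_zero hx
  have hinj : Set.InjOn g (Function.support (B.indicator (1 : X → ℂ))) := by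
    intro x hx x' hx' he
    have hxB := hsupp x hx
    have hxB' := hsupp x' hx'
    refine hc x x' ((dist_triangle_right x x' (g x)).trans (add_le_add (hg x hxB.1).2 ?_))
      (hxB.2.trans hxB'.2.symm)
    rw [he]
    exact (hg x' hxB'.1).2
  obtain ⟨P, -, hP⟩ := exists_weightedComp zero_le_one (norm_indicator_one_le B) hinj
  have hPfin : FinitePropagation P :=
    finitePropagation_of_forall_apply_eq hP fun x hx => (hg x (hsupp x hx).1).2
  let Q : uniformRoeAlgebra X := ⟨P, hPfin.mem_uniformRoeAlgebra⟩
  have hPA : P * indicatorOp A = P := by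
    ext h x
    show P (indicatorOp A h) x = P h x
    rw [hP, hP, indicatorOp_apply]
    by_cases hx : x ∈ B
    · rw [Set.indicator_of_mem (hg x hx.1).1, Pi.one_apply, one_mul]
    · rw [Set.indicator_of_notMem hx, zero_mul, zero_mul]
  have hQ : Q ∈ J := by
    have h : Q * indicatorElem A = Q := Subtype.ext hPA
    rw [← h]
    exact J.mul_mem_left _ _ hA
  refine indicatorElem_mem_of_subset
    (hX.indicatorElem_fst_image_epsSupport_mem hJ hQ one_pos) fun x hx => ?_
  refine ⟨(x, g x), ?_, rfl⟩
  show (1 : ℝ) ≤ ‖coeff P x (g x)‖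
  have h : coeff P x (g x) = B.indicator (1 : X → ℂ) x * (delta (g x) : L2 X) (g x) := hP _ _
  rw [h, Set.indicator_of_mem hx, delta_apply_self]
  simp

end Ideals

section Correspondence

variable {X : Type*} [MetricSpace X]

/-! ### The open set of an ideal -/

theorem BoundedGeometry.mem_openSetOf_iff (hX : BoundedGeometry X)
    {J : TwoSidedIdeal (uniformRoeAlgebra X)} (hJ : IsClosed (J : Set (uniformRoeAlgebra X)))
    {ω : Beta X} :
    ω ∈ openSetOf (J : Set (uniformRoeAlgebra X)) ↔ ∃ A ∈ ω, indicatorElem A ∈ J := by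
  simp only [openSetOf, Set.mem_iUnion, mem_betaClosure]
  constructor
  · rintro ⟨T, hT, ε, hε, hω⟩
    exact ⟨_, hω, hX.indicatorElem_fst_image_epsSupport_mem hJ hT hε⟩
  · rintro ⟨A, hω, hA⟩
    exact ⟨indicatorElem A, hA, 1, one_pos,
      mem_of_superset hω (subset_fst_image_epsSupport_indicatorOp A)⟩

theorem isOpen_openSetOf (I : Set (uniformRoeAlgebra X)) : IsOpen (openSetOf I) :=
  isOpen_biUnion fun _ _ => isOpen_iUnion fun _ => isOpen_iUnion fun _ => isOpen_betaClosure _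

theorem BoundedGeometry.isInvariant_openSetOf (hX : BoundedGeometry X)
    {J : TwoSidedIdeal (uniformRoeAlgebra X)} (hJ : IsClosed (J : Set (uniformRoeAlgebra X))) :
    IsInvariant (openSetOf (J : Set (uniformRoeAlgebra X))) := by
  refine isInvariant_of_forall_sourceMap_mem fun γ hγ hs => ?_
  obtain ⟨A, hA, hAJ⟩ := (hX.mem_openSetOf_iff hJ).1 hs
  obtain ⟨r, -, hr⟩ := mem_coarseGroupoid.1 hγ
  exact (hX.mem_openSetOf_iff hJ).2
    ⟨nbhd r A, nbhd_mem_rangeMap hr hA, hX.indicatorElem_nbhd_mem hJ hAJ r⟩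

/-- By compactness one A with indicator in J has closure βX; principal ultrafilters then give A = X,
so 1 ∈ J. -/
theorem BoundedGeometry.eq_univ_of_openSetOf_eq_univ (hX : BoundedGeometry X)
    {I : Set (uniformRoeAlgebra X)} (hI : IsIdeal I) (h : openSetOf I = Set.univ) :
    I = Set.univ := by
  obtain ⟨hJ, J, rfl⟩ := hI
  obtain ⟨A, hA, hcov⟩ := exists_subset_betaClosure_of_isCompact (K := (Set.univ : Set (Beta X)))
    (𝒜 := {A | indicatorElem A ∈ J}) isCompact_univ ⟨∅, indicatorElem_empty_mem⟩
    (fun A hA B hB =>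
      ⟨A ∪ B, indicatorElem_union_mem hA hB, Set.subset_union_left, Set.subset_union_right⟩)
    (fun ω _ => by
      obtain ⟨A, hω, hA⟩ := (hX.mem_openSetOf_iff hJ).1 (h ▸ Set.mem_univ ω)
      exact Set.mem_biUnion hA (mem_betaClosure.2 hω))
  have hAuniv : A = Set.univ := Set.eq_univ_of_forall fun x =>
    (mem_betaClosure.1 (hcov (Set.mem_univ (pure x))) : A ∈ (pure x : Beta X))
  have h1 : (1 : uniformRoeAlgebra X) ∈ J := by
    rw [← indicatorElem_univ, ← hAuniv]
    exact hA
  refine Set.eq_univ_of_forall fun T => ?_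
  rw [← mul_one T]
  exact J.mul_mem_left T 1 h1

/-! ### Ghostly ideals -/

theorem indicatorElem_mem_ghostlyIdeal {U : Set (Beta X)} {A : Set X} (hA : betaClosure A ⊆ U) :
    indicatorElem A ∈ ghostlyIdeal U :=
  fun _ hε => (betaClosure_mono (fst_image_epsSupport_indicatorOp_subset A hε)).trans hA

theorem ghostlyIdeal_mono {U V : Set (Beta X)} (h : U ⊆ V) : ghostlyIdeal U ⊆ ghostlyIdeal V :=
  fun _ hT ε hε => (hT ε hε).trans h

theorem fst_image_epsSupport_subset_of_norm_sub_le {X : Type*} {S T : L2 X →L[ℂ] L2 X} {ε δ : ℝ}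
    (h : ‖S - T‖ ≤ δ) :
    Prod.fst '' epsSupport S ε ⊆ Prod.fst '' epsSupport T (ε - δ) := by
  rintro _ ⟨⟨x, y⟩, hp, rfl⟩
  refine ⟨(x, y), ?_, rfl⟩
  have hp' : ε ≤ ‖coeff S x y‖ := hp
  have h1 := (norm_coeff_le (S - T) x y).trans h
  rw [coeff_sub] at h1
  have h2 := norm_sub_norm_le (coeff S x y) (coeff T x y)
  show ε - δ ≤ ‖coeff T x y‖
  linarith

theorem fst_image_epsSupport_add_subset {X : Type*} (S T : L2 X →L[ℂ] L2 X) (ε : ℝ) :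
    Prod.fst '' epsSupport (S + T) ε
      ⊆ Prod.fst '' epsSupport S (ε / 2) ∪ Prod.fst '' epsSupport T (ε / 2) := by
  rintro _ ⟨⟨x, y⟩, hp, rfl⟩
  have hp' : ε ≤ ‖coeff S x y + coeff T x y‖ := hp
  have h := hp'.trans (norm_add_le _ _)
  by_cases hS : ε / 2 ≤ ‖coeff S x y‖
  · exact Or.inl ⟨(x, y), hS, rfl⟩
  · refine Or.inr ⟨(x, y), ?_, rfl⟩
    show ε / 2 ≤ ‖coeff T x y‖
    linarith [not_le.1 hS]

theorem epsSupport_neg {X : Type*} (T : L2 X →L[ℂ] L2 X) (ε : ℝ) :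
    epsSupport (-T) ε = epsSupport T ε := by
  ext p
  show ε ≤ ‖coeff (-T) p.1 p.2‖ ↔ ε ≤ ‖coeff T p.1 p.2‖
  rw [coeff_neg, norm_neg]

/-- An entry of S T in row x is a sum of at most N terms involving rows of T near x, so a large
entry forces a large one in T nearby. -/
theorem BoundedGeometry.exists_fst_image_epsSupport_mul_subset_nbhd (hX : BoundedGeometry X)
    {S : L2 X →L[ℂ] L2 X} (hS : FinitePropagation S) (T : L2 X →L[ℂ] L2 X) {ε : ℝ} (hε : 0 < ε) :
    ∃ R δ : ℝ, 0 < δ ∧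
      Prod.fst '' epsSupport (S * T) ε ⊆ nbhd R (Prod.fst '' epsSupport T δ) := by
  obtain ⟨R, hR⟩ := hS
  obtain ⟨N, hN⟩ := hX (max R 1) (lt_max_of_lt_right one_pos)
  have hpos : 0 < N * ‖S‖ + 1 := by positivity
  -- The added 1 keeps the denominator positive when N‖S‖ = 0.
  refine ⟨max R 1, ε / (N * ‖S‖ + 1), by positivity, ?_⟩
  rintro _ ⟨⟨x, y⟩, hp, rfl⟩
  obtain ⟨z, hz, hle⟩ := exists_le_mul_norm_coeff (hN x) (fun z hz _ => by
    rw [Metric.mem_closedBall, dist_comm]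
    exact (hR x z hz).trans (le_max_left _ _)) hε hp
  refine ⟨z, ⟨(z, y), ?_, rfl⟩, by rwa [Metric.mem_closedBall, dist_comm] at hz⟩
  show ε / (N * ‖S‖ + 1) ≤ ‖coeff T z y‖
  rw [div_le_iff₀ hpos]
  calc ε ≤ N * (‖coeff S x z‖ * ‖coeff T z y‖) := hle
    _ ≤ N * (‖S‖ * ‖coeff T z y‖) := by
      gcongr
      exact norm_coeff_le S x z
    _ ≤ ‖coeff T z y‖ * (N * ‖S‖ + 1) := by nlinarith [norm_nonneg (coeff T z y)]

/-- Right multiplication mixes entries within a row of T, so the set of rows need not be enlarged.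
-/
theorem BoundedGeometry.exists_fst_image_epsSupport_mul_subset (hX : BoundedGeometry X)
    (T : L2 X →L[ℂ] L2 X) {S : L2 X →L[ℂ] L2 X} (hS : FinitePropagation S) {ε : ℝ} (hε : 0 < ε) :
    ∃ δ : ℝ, 0 < δ ∧ Prod.fst '' epsSupport (T * S) ε ⊆ Prod.fst '' epsSupport T δ := by
  obtain ⟨R, hR⟩ := hS
  obtain ⟨N, hN⟩ := hX (max R 1) (lt_max_of_lt_right one_pos)
  have hpos : 0 < N * ‖S‖ + 1 := by positivity
  refine ⟨ε / (N * ‖S‖ + 1), by positivity, ?_⟩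
  rintro _ ⟨⟨x, y⟩, hp, rfl⟩
  obtain ⟨z, -, hle⟩ := exists_le_mul_norm_coeff (hN y)
    (fun z _ hz => (hR z y hz).trans (le_max_left _ _)) hε hp
  refine ⟨(x, z), ?_, rfl⟩
  show ε / (N * ‖S‖ + 1) ≤ ‖coeff T x z‖
  rw [div_le_iff₀ hpos]
  calc ε ≤ N * (‖coeff T x z‖ * ‖coeff S z y‖) := hle
    _ ≤ N * (‖coeff T x z‖ * ‖S‖) := by
      gcongr
      exact norm_coeff_le S z y
    _ ≤ ‖coeff T x z‖ * (N * ‖S‖ + 1) := by nlinarith [norm_nonneg (coeff T x z)]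

/-- Membership in a ghostly ideal can be tested on approximations by members. -/
theorem mem_ghostlyIdeal_of_forall_exists {U : Set (Beta X)} {T : uniformRoeAlgebra X}
    (h : ∀ ε : ℝ, 0 < ε → ∃ S : L2 X →L[ℂ] L2 X, ‖(T : L2 X →L[ℂ] L2 X) - S‖ ≤ ε / 2 ∧
      betaClosure (Prod.fst '' epsSupport S (ε / 2)) ⊆ U) : T ∈ ghostlyIdeal U := by
  intro ε hε
  obtain ⟨S, hS, hU⟩ := h ε hε
  refine (betaClosure_mono (fst_image_epsSupport_subset_of_norm_sub_le hS)).trans ?_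
  rwa [sub_half]

theorem isClosed_ghostlyIdeal (U : Set (Beta X)) : IsClosed (ghostlyIdeal U) := by
  refine isClosed_of_closure_subset fun T hT => mem_ghostlyIdeal_of_forall_exists fun ε hε => ?_
  obtain ⟨S, hS, hd⟩ := Metric.mem_closure_iff.1 hT (ε / 2) (half_pos hε)
  rw [dist_eq_norm] at hd
  exact ⟨S, hd.le, hS _ (half_pos hε)⟩

theorem exists_finitePropagation_norm_sub_mul_le {S : L2 X →L[ℂ] L2 X}
    (hS : S ∈ uniformRoeAlgebra X) (M : ℝ) {ε : ℝ} (hε : 0 < ε) :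
    ∃ S', FinitePropagation S' ∧ ‖S - S'‖ * |M| ≤ ε := by
  have hM : 0 < |M| + 1 := by positivity
  obtain ⟨S', hS', hd⟩ := exists_finitePropagation_norm_sub_lt hS (div_pos hε hM)
  refine ⟨S', hS', ?_⟩
  rw [lt_div_iff₀ hM] at hd
  nlinarith [norm_nonneg (S - S')]

/-- Invariance of U absorbs the neighbourhood created by left multiplication with a finite
propagation approximation of S. -/
theorem BoundedGeometry.mul_mem_ghostlyIdeal_left (hX : BoundedGeometry X) {U : Set (Beta X)}
    (hU : IsInvariant U) (S : uniformRoeAlgebra X) {T : uniformRoeAlgebra X}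
    (hT : T ∈ ghostlyIdeal U) : S * T ∈ ghostlyIdeal U := by
  refine mem_ghostlyIdeal_of_forall_exists fun ε hε => ?_
  obtain ⟨S', hS', hd⟩ := exists_finitePropagation_norm_sub_mul_le S.2
    ‖(T : L2 X →L[ℂ] L2 X)‖ (half_pos hε)
  rw [abs_norm] at hd
  obtain ⟨R, δ, hδ, hsub⟩ := hX.exists_fst_image_epsSupport_mul_subset_nbhd hS'
    (T : L2 X →L[ℂ] L2 X) (half_pos hε)
  refine ⟨S' * T, ?_, (betaClosure_mono hsub).trans (hU.betaClosure_nbhd_subset (hT δ hδ) R)⟩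
  show ‖(S : L2 X →L[ℂ] L2 X) * T - S' * T‖ ≤ ε / 2
  rw [← sub_mul]
  exact (norm_mul_le _ _).trans hd

theorem BoundedGeometry.mul_mem_ghostlyIdeal_right (hX : BoundedGeometry X) {U : Set (Beta X)}
    {T : uniformRoeAlgebra X} (hT : T ∈ ghostlyIdeal U) (S : uniformRoeAlgebra X) :
    T * S ∈ ghostlyIdeal U := by
  refine mem_ghostlyIdeal_of_forall_exists fun ε hε => ?_
  obtain ⟨S', hS', hd⟩ := exists_finitePropagation_norm_sub_mul_le S.2
    ‖(T : L2 X →L[ℂ] L2 X)‖ (half_pos hε)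
  rw [abs_norm] at hd
  obtain ⟨δ, hδ, hsub⟩ := hX.exists_fst_image_epsSupport_mul_subset
    (T : L2 X →L[ℂ] L2 X) hS' (half_pos hε)
  refine ⟨T * S', ?_, (betaClosure_mono hsub).trans (hT δ hδ)⟩
  show ‖(T : L2 X →L[ℂ] L2 X) * S - T * S'‖ ≤ ε / 2
  rw [← mul_sub]
  exact (norm_mul_le _ _).trans ((mul_comm _ _).trans_le hd)

theorem zero_mem_ghostlyIdeal (U : Set (Beta X)) : 0 ∈ ghostlyIdeal U := by
  rintro ε hε ω hω
  obtain ⟨_, ⟨p, hp, -⟩⟩ := Ultrafilter.nonempty_of_mem (mem_betaClosure.1 hω)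
  have hp' : ε ≤ ‖coeff (0 : L2 X →L[ℂ] L2 X) p.1 p.2‖ := hp
  rw [coeff_zero, norm_zero] at hp'
  exact absurd hε hp'.not_gt

theorem add_mem_ghostlyIdeal {U : Set (Beta X)} {S T : uniformRoeAlgebra X}
    (hS : S ∈ ghostlyIdeal U) (hT : T ∈ ghostlyIdeal U) : S + T ∈ ghostlyIdeal U := by
  intro ε hε
  refine (betaClosure_mono (fst_image_epsSupport_add_subset _ _ ε)).trans ?_
  rw [betaClosure_union]
  exact Set.union_subset (hS _ (half_pos hε)) (hT _ (half_pos hε))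

theorem neg_mem_ghostlyIdeal {U : Set (Beta X)} {T : uniformRoeAlgebra X}
    (hT : T ∈ ghostlyIdeal U) : -T ∈ ghostlyIdeal U := by
  intro ε hε
  have h := hT ε hε
  rwa [← epsSupport_neg] at h

theorem BoundedGeometry.isIdeal_ghostlyIdeal (hX : BoundedGeometry X) {U : Set (Beta X)}
    (hU : IsInvariant U) : IsIdeal (ghostlyIdeal U) := by
  refine ⟨isClosed_ghostlyIdeal U,
    TwoSidedIdeal.mk' (ghostlyIdeal U) (zero_mem_ghostlyIdeal U) add_mem_ghostlyIdeal
      neg_mem_ghostlyIdeal (fun hT => hX.mul_mem_ghostlyIdeal_left hU _ hT)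
      (fun hT => hX.mul_mem_ghostlyIdeal_right hT _), ?_⟩
  exact TwoSidedIdeal.coe_mk' ..

theorem ghostlyIdeal_ne_univ {U : Set (Beta X)} (hU : U ≠ Set.univ) :
    ghostlyIdeal U ≠ Set.univ := by
  intro h
  refine hU (Set.eq_univ_of_univ_subset ?_)
  have h1 : indicatorElem (Set.univ : Set X) ∈ ghostlyIdeal U := h ▸ Set.mem_univ _
  refine subset_trans ?_ (h1 1 one_pos)
  rw [← betaClosure_univ]
  exact betaClosure_mono (subset_fst_image_epsSupport_indicatorOp _)

theorem subset_ghostlyIdeal_openSetOf (I : Set (uniformRoeAlgebra X)) :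
    I ⊆ ghostlyIdeal (openSetOf I) := by
  intro T hT ε hε ω hω
  simp only [openSetOf, Set.mem_iUnion]
  exact ⟨T, hT, ε, hε, hω⟩

theorem openSetOf_mono {I J : Set (uniformRoeAlgebra X)} (h : I ⊆ J) :
    openSetOf I ⊆ openSetOf J :=
  Set.biUnion_subset_biUnion_left h

/-- Basic closed-open sets inside U have their indicators in Ĩ(U), and these already exhaust U. -/
theorem openSetOf_ghostlyIdeal {U : Set (Beta X)} (hU : IsOpen U) :
    openSetOf (ghostlyIdeal U) = U := by
  refine subset_antisymm ?_ fun ω hω => ?_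
  · intro ω hω
    simp only [openSetOf, Set.mem_iUnion] at hω
    obtain ⟨T, hT, ε, hε, hω⟩ := hω
    exact hT ε hε hω
  · obtain ⟨A, hA, hAU⟩ := exists_betaClosure_subset hU hω
    simp only [openSetOf, Set.mem_iUnion]
    exact ⟨indicatorElem A, indicatorElem_mem_ghostlyIdeal hAU, 1, one_pos,
      betaClosure_mono (subset_fst_image_epsSupport_indicatorOp A) (mem_betaClosure.2 hA)⟩

/-! ### Maximal ideals -/

/-- A proper ideal I above Ĩ(U) has a proper U(I) ⊇ U, hence U(I) = U by maximality and I ⊆ Ĩ(U(I))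
= Ĩ(U). -/
theorem BoundedGeometry.isMaximalIdeal_ghostlyIdeal (hX : BoundedGeometry X) {U : Set (Beta X)}
    (hU : IsMaximalInvariantOpen U) : IsMaximalIdeal (ghostlyIdeal U) := by
  obtain ⟨⟨hopen, hinv⟩, hne, hmax⟩ := hU
  refine ⟨hX.isIdeal_ghostlyIdeal hinv, ghostlyIdeal_ne_univ hne, fun I hI hsub hIne => ?_⟩
  have hUI : U ⊆ openSetOf I :=
    (openSetOf_ghostlyIdeal hopen).symm.trans_subset (openSetOf_mono hsub)
  have hIinv : IsInvariant (openSetOf I) := by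
    obtain ⟨hJ, J, rfl⟩ := hI
    exact hX.isInvariant_openSetOf hJ
  have heq : U = openSetOf I := by
    by_contra h
    exact hmax _ (isOpen_openSetOf I) hIinv
      (fun h => hIne (hX.eq_univ_of_openSetOf_eq_univ hI h)) (hUI.ssubset_of_ne h)
  refine subset_antisymm ?_ hsub
  rw [heq]
  exact subset_ghostlyIdeal_openSetOf I

theorem BoundedGeometry.isMaximalInvariantOpen_openSetOf (hX : BoundedGeometry X)
    {I : Set (uniformRoeAlgebra X)} (hI : IsMaximalIdeal I) :
    IsMaximalInvariantOpen (openSetOf I) ∧ I = ghostlyIdeal (openSetOf I) := by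
  obtain ⟨hideal, hne, hmax⟩ := hI
  have hinv : IsInvariant (openSetOf I) := by
    obtain ⟨hJ, J, rfl⟩ := hideal
    exact hX.isInvariant_openSetOf hJ
  have hUne : openSetOf I ≠ Set.univ := fun h => hne (hX.eq_univ_of_openSetOf_eq_univ hideal h)
  -- Each such Ĩ(V) is a proper ideal containing I, so maximality gives equality. V = U(I) yields
  -- the formula for I; for open V, applying U(·) gives V = U(I).
  have hV : ∀ V : Set (Beta X), IsInvariant V → V ≠ Set.univ → openSetOf I ⊆ V →
      ghostlyIdeal V = I := fun V hVi hVne hsub =>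
    hmax _ (hX.isIdeal_ghostlyIdeal hVi)
      ((subset_ghostlyIdeal_openSetOf I).trans (ghostlyIdeal_mono hsub)) (ghostlyIdeal_ne_univ hVne)
  refine ⟨⟨⟨isOpen_openSetOf I, hinv⟩, hUne, fun V hVo hVi hVne hss => ?_⟩,
    (hV _ hinv hUne subset_rfl).symm⟩
  refine hss.ne ?_
  rw [← hV V hVi hVne hss.subset, openSetOf_ghostlyIdeal hVo]

theorem BoundedGeometry.exists_isMinimalInvariantClosed_eq_ghostlyIdeal_compl
    (hX : BoundedGeometry X) {I : Set (uniformRoeAlgebra X)} (hI : IsMaximalIdeal I) :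
    ∃ K : Set (Beta X), IsMinimalInvariantClosed K ∧ I = ghostlyIdeal Kᶜ := by
  obtain ⟨hU, he⟩ := hX.isMaximalInvariantOpen_openSetOf hI
  exact ⟨(openSetOf I)ᶜ, isMinimalInvariantClosed_compl_iff.2 hU, by rwa [compl_compl]⟩

end Correspondence

end Roe

end

/-! ### The classification of maximal ideals -/

theorem mainTheorem3 {X : Type*} [MetricSpace X]
    (hdisc : Roe.StronglyDiscrete X) (hgeom : Roe.BoundedGeometry X) :
    -- maximal ideals in terms of maximal invariant open sets
    (∀ U : Set (Roe.Beta X), Roe.IsMaximalInvariantOpen U →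
      Roe.IsMaximalIdeal (Roe.ghostlyIdeal U)) ∧
    (∀ I : Set (Roe.uniformRoeAlgebra X), Roe.IsMaximalIdeal I →
      Roe.IsMaximalInvariantOpen (Roe.openSetOf I) ∧
        I = Roe.ghostlyIdeal (Roe.openSetOf I)) ∧
    -- maximal ideals in terms of minimal invariant closed sets
    (∀ K : Set (Roe.Beta X), Roe.IsMinimalInvariantClosed K →
      Roe.IsMaximalIdeal (Roe.ghostlyIdeal Kᶜ)) ∧
    (∀ I : Set (Roe.uniformRoeAlgebra X), Roe.IsMaximalIdeal I →
      ∃ K : Set (Roe.Beta X), Roe.IsMinimalInvariantClosed K ∧ I = Roe.ghostlyIdeal Kᶜ) ∧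
    -- minimal invariant closed sets and maximal ideals in terms of minimal points
    (Infinite X →
      (∀ K : Set (Roe.Beta X), Roe.IsMinimalInvariantClosed K →
        ∃ ω ∈ Roe.boundary X, Roe.IsMinimalPoint ω ∧ K = closure (Roe.limitSpace ω)) ∧
      (∀ I : Set (Roe.uniformRoeAlgebra X), Roe.IsMaximalIdeal I →
        ∃ ω ∈ Roe.boundary X, Roe.IsMinimalPoint ω ∧
          I = Roe.ghostlyIdeal (closure (Roe.limitSpace ω))ᶜ)) ∧
    (∀ ω ∈ Roe.boundary X, Roe.IsMinimalPoint ω →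
      Roe.IsMinimalInvariantClosed (closure (Roe.limitSpace ω))) := by
  refine ⟨fun U hU => hgeom.isMaximalIdeal_ghostlyIdeal hU,
    fun I hI => hgeom.isMaximalInvariantOpen_openSetOf hI,
    fun K hK => hgeom.isMaximalIdeal_ghostlyIdeal
      (Roe.isMinimalInvariantClosed_compl_iff.1 (by rwa [compl_compl])),
    fun I hI => hgeom.exists_isMinimalInvariantClosed_eq_ghostlyIdeal_compl hI,
    fun hinf => ⟨fun K hK => hgeom.exists_isMinimalPoint hK, fun I hI => ?_⟩,
    fun ω _ hω => hω.2⟩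
  obtain ⟨K, hK, rfl⟩ := hgeom.exists_isMinimalInvariantClosed_eq_ghostlyIdeal_compl hI
  obtain ⟨ω, hb, hω, rfl⟩ := hgeom.exists_isMinimalPoint hK
  exact ⟨ω, hb, hω, rfl⟩
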